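/- Let $\Bbbk$ be a field. A groupoid is a small category in which every arrow is invertible; for an arrow $a$, write $s(a)$ and $t(a)$ for its source and target, and write $fg$ for the composite of $f$ and $g$ when $s(f)=t(g)$. A groupoid is called \emph{finite} if it has finitely many connected components and each of its isotropy groups is finite. For a groupoid $\mathcal{G}$, let $\mathrm{Rep}_{\Bbbk}(\mathcal{G})$ be the category of functors from $\mathcal{G}$ to $\Bbbk$-vector spaces. Let $\varphi\colon\mathcal{H}\to\mathcal{G}$ be a morphism of groupoids (a functor), with object map $\varphi_0$ and arrow map $\varphi_1$. The left pull-back biset of $\varphi$ is the set of pairs $(u,a)$, with $u\in\mathcal{H}_0$ and $a\in\mathcal{G}_1$ such that $t(a)=\varphi_0(u)$. It carries the map $\vartheta(u,a)=s(a)$ to $\mathcal{G}_0$, and each fibre $\vartheta^{-1}(\{x\})$ is a left $\mathcal{H}$-set under $h(u,a)=(t(h),\varphi_1(h)a)$ for $s(h)=u$. The right pull-back biset of $\varphi$ is the set of pairs $(a,u)$, with $a\in\mathcal{G}_1$ and $u\in\mathcal{H}_0$ such that $s(a)=\varphi_0(u)$. It carries the map $\varsigma(a,u)=t(a)$ to $\mathcal{G}_0$,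 and each fibre $\varsigma^{-1}(\{x\})$ is a right $\mathcal{H}$-set under $(a,u)h=(a\varphi_1(h),s(h))$ for $t(h)=u$. The induction functor $\varphi^{*}\colon\mathrm{Rep}_{\Bbbk}(\mathcal{H})\to\mathrm{Rep}_{\Bbbk}(\mathcal{G})$ is defined by $\varphi^{*}(W)_x=\mathrm{Nat}\big(\mathcal{G}(x,\varphi_0(-)),W\big)$, the space of natural transformations of set-valued functors on $\mathcal{H}$ with componentwise operations, an arrow $g\colon x\to y$ of $\mathcal{G}$ acting by $\alpha\mapsto(q\mapsto\alpha(qg))$. The co-induction functor ${}^{*}\varphi\colon\mathrm{Rep}_{\Bbbk}(\mathcal{H})\to\mathrm{Rep}_{\Bbbk}(\mathcal{G})$ is defined by letting ${}^{*}\varphi(W)_x$ be the colimit of $(a,u)\mapsto W_u$ over the right translation groupoid $\varsigma^{-1}(\{x\})\rtimes\mathcal{H}$ (its objects are the elements of $\varsigma^{-1}(\{x\})$, and an arrow from $p$ to $q$ is an arrow $h$ of $\mathcal{H}$ with $qh=p$), an arrow $g\colon x\to y$ of $\mathcal{G}$ acting by sending the copy of $W_u$ at $(a,u)$ identically to the copy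 of $W_u$ at $(ga,u)$. The morphism $\varphi$ is called \emph{Frobenius} if the functors $\varphi^{*}$ and ${}^{*}\varphi$ are naturally isomorphic. \textbf{Corollary.} Assume that $\varphi$ is faithful and that $\varphi_0\colon\mathcal{H}_0\to\mathcal{G}_0$ is injective (for example, $\varphi$ is the inclusion of a subgroupoid). Then the following are equivalent: (a) $\varphi$ is Frobenius; (b) for every $x\in\mathcal{G}_0$, the left $\mathcal{H}$-set $\vartheta^{-1}(\{x\})$ has finitely many orbits; (c) for every $x\in\mathcal{G}_0$, the right $\mathcal{H}$-set $\varsigma^{-1}(\{x\})$ has finitely many orbits. In particular, if moreover $\mathcal{H}$ and $\mathcal{G}$ are finite groupoids, then $\varphi$ is Frobenius; thus any inclusion of finite groupoids is Frobenius. -/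

import Mathlib

open CategoryTheory CategoryTheory.Limits

universe u

namespace GroupoidFrobenius

/-! ### Groupoids, connected components, finite groupoids

Composition is written in diagrammatic order: the product `f g` of two arrows with `s(f) = t(g)`
is `g ≫ f`. -/

/-- Two objects of a groupoid are equivalent when some arrow connects them. -/
def connectedSetoid (G : Type u) [Groupoid.{u} G] : Setoid G where
  r x y := Nonempty (x ⟶ y)
  iseqv :=
    { refl := fun x => ⟨𝟙 x⟩
      symm := fun ⟨f⟩ => ⟨Groupoid.inv f⟩
      trans := fun ⟨f⟩ ⟨g⟩ => ⟨f ≫ g⟩ }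

/-- The set `π₀(G)` of connected components (the orbit set of the groupoid `G`). -/
def Pi0 (G : Type u) [Groupoid.{u} G] : Type u := Quotient (connectedSetoid G)

/-- A groupoid is finite when it has finitely many connected components and every
isotropy group is finite. -/
def IsFiniteGroupoid (G : Type u) [Groupoid.{u} G] : Prop :=
  Finite (Pi0 G) ∧ ∀ x : G, Finite (x ⟶ x)

/-! ### Left and right groupoid-sets, translation groupoids and orbits -/

/-- A left `H`-set: `act h p e` is `h p`, defined when the structure map sends `p` to `s(h)`. -/
structure LeftGSet (H : Type u) [Groupoid.{u} H] where
  carrier : Type u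
  st : carrier → H
  act : ∀ {v w : H} (_ : v ⟶ w) (p : carrier), st p = v → carrier
  st_act : ∀ {v w : H} (h : v ⟶ w) (p : carrier) (e : st p = v), st (act h p e) = w
  act_id : ∀ p : carrier, act (𝟙 (st p)) p rfl = p
  act_comp : ∀ {v w z : H} (h : v ⟶ w) (k : w ⟶ z) (p : carrier) (e : st p = v),
    act (h ≫ k) p e = act k (act h p e) (st_act h p e)

/-- A right `H`-set: `act p h e` is `p h`, defined when the structure map sends `p` to `t(h)`. -/
structure RightGSet (H : Type u) [Groupoid.{u} H] where
  carrier : Type u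
  st : carrier → H
  act : ∀ {v w : H} (p : carrier) (_ : v ⟶ w), st p = w → carrier
  st_act : ∀ {v w : H} (p : carrier) (h : v ⟶ w) (e : st p = w), st (act p h e) = v
  act_id : ∀ p : carrier, act p (𝟙 (st p)) rfl = p
  act_comp : ∀ {v w z : H} (p : carrier) (h : v ⟶ w) (k : w ⟶ z) (e : st p = z),
    act p (h ≫ k) e = act (act p k e) h (st_act p k e)

section LeftSets

variable {H : Type u} [Groupoid.{u} H]

theorem LeftGSet.act_congr (X : LeftGSet H) {v w : H} (h : v ⟶ w) {p q : X.carrier} (hpq : p = q)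
    (e : X.st p = v) (e' : X.st q = v) : X.act h p e = X.act h q e' := by
  subst hpq; rfl

/-- The left `H`-set structure on an `H`-invariant subset. -/
def LeftGSet.sub (X : LeftGSet H) (S : Set X.carrier)
    (hS : ∀ {v w : H} (h : v ⟶ w) (p : X.carrier) (e : X.st p = v), p ∈ S → X.act h p e ∈ S) :
    LeftGSet H where
  carrier := {p : X.carrier // p ∈ S}
  st p := X.st p.1
  act h p e := ⟨X.act h p.1 e, hS h p.1 e p.2⟩
  st_act h p e := X.st_act h p.1 e
  act_id p := Subtype.ext (X.act_id p.1)
  act_comp h k p e := Subtype.ext (X.act_comp h k p.1 e)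

/-- The objects of the left translation groupoid `H ⋉ X`: the elements of `X`. -/
@[ext]
structure LeftTranslation (X : LeftGSet H) : Type u where
  pt : X.carrier

/-- The left translation groupoid: an arrow from `p` to `q` is an arrow `h` of `H` with
`h p = q`. -/
instance (X : LeftGSet H) : Groupoid.{u} (LeftTranslation X) where
  Hom p q := {h : X.st p.pt ⟶ X.st q.pt // X.act h p.pt rfl = q.pt}
  id p := ⟨𝟙 _, X.act_id p.pt⟩
  comp {p q r} h k := ⟨h.1 ≫ k.1, by
    rw [X.act_comp, X.act_congr k.1 h.2 _ rfl, k.2]⟩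
  inv {p q} h := ⟨Groupoid.inv h.1, by
    rw [← X.act_congr _ h.2 (X.st_act _ _ _) rfl, ← X.act_comp, Groupoid.comp_inv, X.act_id]⟩
  id_comp _ := Subtype.ext (Category.id_comp _)
  comp_id _ := Subtype.ext (Category.comp_id _)
  assoc _ _ _ := Subtype.ext (Category.assoc _ _ _)
  inv_comp _ := Subtype.ext (Groupoid.inv_comp _)
  comp_inv _ := Subtype.ext (Groupoid.comp_inv _)

/-- The orbit set of a left `H`-set. -/
def LeftGSet.Orbits (X : LeftGSet H) : Type u := Pi0 (LeftTranslation X)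

end LeftSets

section RightSets

variable {H : Type u} [Groupoid.{u} H]

theorem RightGSet.act_congr (X : RightGSet H) {v w : H} (h : v ⟶ w) {p q : X.carrier}
    (hpq : p = q) (e : X.st p = w) (e' : X.st q = w) : X.act p h e = X.act q h e' := by
  subst hpq; rfl

/-- The right `H`-set structure on an `H`-invariant subset. -/
def RightGSet.sub (X : RightGSet H) (S : Set X.carrier)
    (hS : ∀ {v w : H} (p : X.carrier) (h : v ⟶ w) (e : X.st p = w), p ∈ S → X.act p h e ∈ S) :
    RightGSet H where
  carrier := {p : X.carrier // p ∈ S}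
  st p := X.st p.1
  act p h e := ⟨X.act p.1 h e, hS p.1 h e p.2⟩
  st_act p h e := X.st_act p.1 h e
  act_id p := Subtype.ext (X.act_id p.1)
  act_comp p h k e := Subtype.ext (X.act_comp p.1 h k e)

/-- The objects of the right translation groupoid `X ⋊ H`: the elements of `X`. -/
@[ext]
structure RightTranslation (X : RightGSet H) : Type u where
  pt : X.carrier

/-- The right translation groupoid: the pair `(q, h)` is an arrow with source `q h` and
target `q`, so an arrow from `p` to `q` is an arrow `h` of `H` with `q h = p`. -/
instance (X : RightGSet H) : Groupoid.{u} (RightTranslation X) where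
  Hom p q := {h : X.st p.pt ⟶ X.st q.pt // X.act q.pt h rfl = p.pt}
  id p := ⟨𝟙 _, X.act_id p.pt⟩
  comp {p q r} h k := ⟨h.1 ≫ k.1, by
    rw [X.act_comp, X.act_congr h.1 k.2 _ rfl, h.2]⟩
  inv {p q} h := ⟨Groupoid.inv h.1, by
    rw [← X.act_congr _ h.2 (X.st_act _ _ _) rfl, ← X.act_comp, Groupoid.inv_comp, X.act_id]⟩
  id_comp _ := Subtype.ext (Category.id_comp _)
  comp_id _ := Subtype.ext (Category.comp_id _)
  assoc _ _ _ := Subtype.ext (Category.assoc _ _ _)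
  inv_comp _ := Subtype.ext (Groupoid.inv_comp _)
  comp_inv _ := Subtype.ext (Groupoid.comp_inv _)

/-- The orbit set of a right `H`-set. -/
def RightGSet.Orbits (X : RightGSet H) : Type u := Pi0 (RightTranslation X)

/-- The canonical morphism of groupoids `X ⋊ H → H`. -/
def RightGSet.proj (X : RightGSet H) : RightTranslation X ⥤ H where
  obj p := X.st p.pt
  map h := h.1
  map_id _ := rfl
  map_comp _ _ := rfl

end RightSets

/-! ### The pull-back bisets of a morphism of groupoids -/

section Pullbacks

variable {H G : Type u} [Groupoid.{u} H] [Groupoid.{u} G] (φ : H ⥤ G)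

/-- Underlying set of the left pull-back biset: pairs `(u, a)` of an object `u` of `H` and an
arrow `a` of `G` with `t(a) = φ(u)`; the field `src` is the source of `a`. -/
structure LeftPullback where
  obj : H
  src : G
  arr : src ⟶ φ.obj obj

/-- The map `ϑ(u, a) = s(a)`. -/
def LeftPullback.theta {φ : H ⥤ G} (p : LeftPullback φ) : G := p.src

/-- The left `H`-action `h (u, a) = (t(h), φ(h) a)` on the left pull-back biset. -/
def leftPullbackLeft : LeftGSet H where
  carrier := LeftPullback φ
  st p := p.obj
  act {_ w} h p e := ⟨w, p.src, p.arr ≫ φ.map (eqToHom e ≫ h)⟩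
  st_act _ _ _ := rfl
  act_id p := by cases p; simp
  act_comp h k p e := by cases p; simp

/-- The right `G`-action `(u, a) g = (u, a g)` on the left pull-back biset. -/
def leftPullbackRight : RightGSet G where
  carrier := LeftPullback φ
  st p := p.theta
  act {v _} p g e := ⟨p.obj, v, g ≫ eqToHom e.symm ≫ p.arr⟩
  st_act _ _ _ := rfl
  act_id p := by
    obtain ⟨u, x, a⟩ := p
    change LeftPullback.mk u x (𝟙 _ ≫ 𝟙 _ ≫ a) = LeftPullback.mk u x a
    simp
  act_comp p g k e := by
    obtain ⟨u, x, a⟩ := p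
    change x = _ at e
    subst e
    change LeftPullback.mk u _ ((g ≫ k) ≫ 𝟙 _ ≫ a) = LeftPullback.mk u _ (g ≫ 𝟙 _ ≫ k ≫ 𝟙 _ ≫ a)
    simp

/-- The left `H`-set `ϑ⁻¹({x})`. -/
def thetaFibre (x : G) : LeftGSet H :=
  (leftPullbackLeft φ).sub {p : LeftPullback φ | p.theta = x} (fun _ _ _ hp => hp)

/-- Underlying set of the right pull-back biset: pairs `(a, u)` of an object `u` of `H` and an
arrow `a` of `G` with `s(a) = φ(u)`; the field `tgt` is the target of `a`. -/
structure RightPullback where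
  obj : H
  tgt : G
  arr : φ.obj obj ⟶ tgt

/-- The map `ς(a, u) = t(a)`. -/
def RightPullback.sigma {φ : H ⥤ G} (p : RightPullback φ) : G := p.tgt

/-- The right `H`-action `(a, u) h = (a φ(h), s(h))` on the right pull-back biset. -/
def rightPullbackRight : RightGSet H where
  carrier := RightPullback φ
  st p := p.obj
  act {v _} p h e := ⟨v, p.tgt, φ.map (h ≫ eqToHom e.symm) ≫ p.arr⟩
  st_act _ _ _ := rfl
  act_id p := by cases p; simp
  act_comp p h k e := by cases p; simp

/-- The left `G`-action `g (a, u) = (g a, u)` on the right pull-back biset. -/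
def rightPullbackLeft : LeftGSet G where
  carrier := RightPullback φ
  st p := p.sigma
  act {_ w} g p e := ⟨p.obj, w, p.arr ≫ eqToHom e ≫ g⟩
  st_act _ _ _ := rfl
  act_id p := by
    obtain ⟨u, x, a⟩ := p
    change RightPullback.mk u x (a ≫ 𝟙 _ ≫ 𝟙 _) = RightPullback.mk u x a
    simp
  act_comp g k p e := by
    obtain ⟨u, x, a⟩ := p
    change x = _ at e
    subst e
    change RightPullback.mk u _ (a ≫ 𝟙 _ ≫ g ≫ k) = RightPullback.mk u _ ((a ≫ 𝟙 _ ≫ g) ≫ 𝟙 _ ≫ k)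
    simp

/-- The right `H`-set `ς⁻¹({x})`. -/
def sigmaFibre (x : G) : RightGSet H :=
  (rightPullbackRight φ).sub {p : RightPullback φ | p.sigma = x} (fun _ _ _ hp => hp)

/-- The isomorphism of translation groupoids `ς⁻¹({s(g)}) ⋊ H → ς⁻¹({t(g)}) ⋊ H` which sends
`((a, u), h)` to `((g a, u), h)`. -/
def sigmaTranslate {x y : G} (g : x ⟶ y) :
    RightTranslation (sigmaFibre φ x) ⥤ RightTranslation (sigmaFibre φ y) where
  obj p := ⟨⟨(rightPullbackLeft φ).act g p.pt.1 p.pt.2, rfl⟩⟩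
  map {p q} h := ⟨h.1, by
    obtain ⟨⟨⟨u, x₁, a⟩, hp⟩⟩ := p
    obtain ⟨⟨⟨v, x₂, b⟩, hq⟩⟩ := q
    obtain ⟨h, hh⟩ := h
    subst hp
    change x₂ = x₁ at hq
    subst hq
    change u ⟶ v at h
    have hh' := congrArg Subtype.val hh
    change RightPullback.mk u x₂ (φ.map (h ≫ 𝟙 _) ≫ b) = RightPullback.mk u x₂ a at hh'
    simp only [Category.comp_id, RightPullback.mk.injEq, heq_eq_eq, true_and] at hh'
    subst hh'
    apply Subtype.ext
    change RightPullback.mk u y (φ.map (h ≫ 𝟙 _) ≫ b ≫ 𝟙 _ ≫ g)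
      = RightPullback.mk u y ((φ.map h ≫ b) ≫ 𝟙 _ ≫ g)
    simp⟩
  map_id _ := rfl
  map_comp _ _ := rfl

theorem sigmaTranslate_id (x : G) (p : RightTranslation (sigmaFibre φ x)) :
    (sigmaTranslate φ (𝟙 x)).obj p = p := by
  obtain ⟨⟨⟨u, x₁, a⟩, hp⟩⟩ := p
  subst hp
  exact RightTranslation.ext (Subtype.ext ((rightPullbackLeft φ).act_id _))

theorem sigmaTranslate_comp {x y z : G} (g : x ⟶ y) (k : y ⟶ z)
    (p : RightTranslation (sigmaFibre φ x)) :
    (sigmaTranslate φ (g ≫ k)).obj p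
      = (sigmaTranslate φ k).obj ((sigmaTranslate φ g).obj p) :=
  RightTranslation.ext (Subtype.ext ((rightPullbackLeft φ).act_comp _ _ _ _))

end Pullbacks

/-! ### Linear representations, induction and co-induction -/

section Representations

variable (k : Type u) [Field k]

/-- The category of `k`-linear representations of a groupoid. -/
abbrev GRep (G : Type u) [Groupoid.{u} G] := G ⥤ ModuleCat.{u} k

variable {k} {H G : Type u} [Groupoid.{u} H] [Groupoid.{u} G] (φ : H ⥤ G)

/-- The vector space of natural transformations from the functor `u ↦ G(x, φ(u))` to the
underlying functor of `W` from `H` to sets, with componentwise operations. -/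
def natSpace (W : GRep k H) (x : G) : Submodule k (∀ u : H, (x ⟶ φ.obj u) → W.obj u) where
  carrier := {α | ∀ (u v : H) (h : u ⟶ v) (p : x ⟶ φ.obj u),
    α v (p ≫ φ.map h) = (W.map h).hom (α u p)}
  add_mem' hα hβ u v h p := by simp [hα u v h p, hβ u v h p]
  zero_mem' u v h p := by simp
  smul_mem' c α hα u v h p := by simp [hα u v h p]

/-- The map `Nat(φˣ, W) → Nat(φʸ, W)` induced by an arrow `g : x ⟶ y`, sending `α` to
`q ↦ α(q g)`. -/
def natMap (W : GRep k H) {x y : G} (g : x ⟶ y) : natSpace φ W x →ₗ[k] natSpace φ W y where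
  toFun α := ⟨fun u q => α.1 u (g ≫ q), fun u v h p => by
    simpa using α.2 u v h (g ≫ p)⟩
  map_add' _ _ := rfl
  map_smul' _ _ := rfl

/-- The induced representation `φ^*(W)`. -/
def inductionObj (W : GRep k H) : GRep k G where
  obj x := ModuleCat.of k (natSpace φ W x)
  map g := ModuleCat.ofHom (natMap φ W g)
  map_id x := by
    ext α u q
    exact congrArg (α.1 u) (Category.id_comp q)
  map_comp f g := by
    ext α u q
    exact congrArg (α.1 u) (Category.assoc f g q)

/-- Composition with a morphism of representations, on spaces of natural transformations. -/
def natPost {W W' : GRep k H} (f : W ⟶ W') (x : G) : natSpace φ W x →ₗ[k] natSpace φ W' x where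
  toFun α := ⟨fun u q => (f.app u).hom (α.1 u q), fun u v h p => by
    dsimp only
    rw [α.2 u v h p, ← ModuleCat.comp_apply, f.naturality, ModuleCat.comp_apply]⟩
  map_add' α β := by
    apply Subtype.ext
    funext u q
    exact map_add (f.app u).hom _ _
  map_smul' c α := by
    apply Subtype.ext
    funext u q
    exact map_smul (f.app u).hom _ _

variable (k) in
/-- The induction functor `φ^* : Rep(H) ⥤ Rep(G)`, given on objects by
`φ^*(W)(x) = Nat(φˣ, W)`. -/
def induction : GRep k H ⥤ GRep k G where
  obj W := inductionObj φ W
  map f :=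
    { app := fun x => ModuleCat.ofHom (natPost φ f x)
      naturality := fun _ _ _ => rfl }
  map_id _ := rfl
  map_comp _ _ := rfl

/-- The diagram `ς⁻¹({x}) ⋊ H ⥤ H ⥤ Vect`, with value `W(u)` at `(a, u)`. -/
abbrev fibreDiagram (W : GRep k H) (x : G) :
    RightTranslation (sigmaFibre φ x) ⥤ ModuleCat.{u} k :=
  (sigmaFibre φ x).proj ⋙ W

/-- The vector space `colim (ς⁻¹({x}) ⋊ H ⥤ H ⥤ Vect)`. -/
noncomputable def coindSpace (W : GRep k H) (x : G) : ModuleCat.{u} k :=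
  colimit (fibreDiagram φ W x)

/-- The structural map `W(u) → colim` at `(a, u)`. -/
noncomputable def coindι (W : GRep k H) (x : G) (p : RightTranslation (sigmaFibre φ x)) :
    W.obj ((sigmaFibre φ x).st p.pt) ⟶ coindSpace φ W x :=
  colimit.ι (fibreDiagram φ W x) p

/-- The unique linear map with `ι_(a, u) ≫ coindMap g = ι_(g a, u)`. -/
noncomputable def coindMap (W : GRep k H) {x y : G} (g : x ⟶ y) :
    coindSpace φ W x ⟶ coindSpace φ W y :=
  colimit.desc (fibreDiagram φ W x)
    { pt := coindSpace φ W y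
      ι :=
        { app := fun p => coindι φ W y ((sigmaTranslate φ g).obj p)
          naturality := fun _ _ h =>
            (colimit.w (fibreDiagram φ W y) ((sigmaTranslate φ g).map h)).trans
              (Category.comp_id _).symm } }

theorem coindι_map (W : GRep k H) {x y : G} (g : x ⟶ y)
    (p : RightTranslation (sigmaFibre φ x)) :
    coindι φ W x p ≫ coindMap φ W g = coindι φ W y ((sigmaTranslate φ g).obj p) :=
  colimit.ι_desc _ _

theorem coind_hom_ext (W : GRep k H) (x : G) {V : ModuleCat.{u} k} {f g : coindSpace φ W x ⟶ V}
    (h : ∀ p, coindι φ W x p ≫ f = coindι φ W x p ≫ g) : f = g :=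
  colimit.hom_ext h

theorem coindι_congr (W : GRep k H) (x : G) {p q : RightTranslation (sigmaFibre φ x)}
    (h : p = q) :
    coindι φ W x p
      = eqToHom (congrArg (fun r => W.obj ((sigmaFibre φ x).st r.pt)) h) ≫ coindι φ W x q := by
  subst h; simp

/-- The co-induced representation `^*φ(W)`. -/
noncomputable def coinductionObj (W : GRep k H) : GRep k G where
  obj x := coindSpace φ W x
  map g := coindMap φ W g
  map_id x := coind_hom_ext φ W x fun p => by
    refine (coindι_map φ W (𝟙 x) p).trans ?_
    rw [coindι_congr φ W x (sigmaTranslate_id φ x p)]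
    exact (Category.id_comp _).trans (Category.comp_id _).symm
  map_comp {x y z} f g := coind_hom_ext φ W x fun p => by
    refine (coindι_map φ W (f ≫ g) p).trans ?_
    refine Eq.trans ?_ (Category.assoc _ _ _)
    refine Eq.trans ?_ (congrArg (· ≫ coindMap φ W g) (coindι_map φ W f p).symm)
    refine Eq.trans ?_ (coindι_map φ W g ((sigmaTranslate φ f).obj p)).symm
    rw [coindι_congr φ W z (sigmaTranslate_comp φ f g p)]
    exact Category.id_comp _

/-- The unique linear map with `ι_(a, u) ≫ coindPost f x = f_u ≫ ι_(a, u)`. -/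
noncomputable def coindPost {W W' : GRep k H} (f : W ⟶ W') (x : G) :
    coindSpace φ W x ⟶ coindSpace φ W' x :=
  colim.map (Functor.whiskerLeft (sigmaFibre φ x).proj f)

theorem coindι_post {W W' : GRep k H} (f : W ⟶ W') (x : G)
    (p : RightTranslation (sigmaFibre φ x)) :
    coindι φ W x p ≫ coindPost φ f x = f.app _ ≫ coindι φ W' x p :=
  ι_colimMap _ _

variable (k) in
/-- The co-induction functor `^*φ : Rep(H) ⥤ Rep(G)`, given on objects by the colimits
`^*φ(W)(x) = colim (ς⁻¹({x}) ⋊ H ⥤ H ⥤ Vect)`. -/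
noncomputable def coinduction : GRep k H ⥤ GRep k G where
  obj W := coinductionObj φ W
  map {W W'} f :=
    { app := fun x => coindPost φ f x
      naturality := fun x y g => coind_hom_ext φ W x fun p => by
        change coindι φ W x p ≫ coindMap φ W g ≫ coindPost φ f y
          = coindι φ W x p ≫ coindPost φ f x ≫ coindMap φ W' g
        refine (Category.assoc _ _ _).symm.trans ?_
        refine (congrArg (· ≫ coindPost φ f y) (coindι_map φ W g p)).trans ?_
        refine (coindι_post φ f y ((sigmaTranslate φ g).obj p)).trans ?_
        refine Eq.trans ?_ (Category.assoc _ _ _)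
        refine Eq.trans ?_ (congrArg (· ≫ coindMap φ W' g) (coindι_post φ f x p).symm)
        refine Eq.trans ?_ (Category.assoc _ _ _).symm
        exact congrArg (f.app _ ≫ ·) (coindι_map φ W' g p).symm }
  map_id W := by
    ext1
    funext x
    refine coind_hom_ext φ W x fun p => ?_
    refine (coindι_post φ (𝟙 W) x p).trans ?_
    exact (Category.id_comp _).trans (Category.comp_id _).symm
  map_comp {W W' W''} f g := by
    ext1
    funext x
    refine coind_hom_ext φ W x fun p => ?_
    change coindι φ W x p ≫ coindPost φ (f ≫ g) x
      = coindι φ W x p ≫ coindPost φ f x ≫ coindPost φ g x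
    rw [coindι_post, ← Category.assoc, coindι_post, Category.assoc, coindι_post]
    exact Category.assoc _ _ _

variable (k) in
/-- A morphism of groupoids is Frobenius (over `k`) when its induction and co-induction functors
are naturally isomorphic. -/
def IsFrobenius : Prop := Nonempty (induction k φ ≅ coinduction k φ)

end Representations

end GroupoidFrobenius

/-!
Inversion `(u, a) ↦ (a⁻¹, u)` identifies the left `H`-set `ϑ⁻¹({x})` with the right `H`-set
`ς⁻¹({x})`, so the two finiteness conditions agree (`thetaOrbitsEquiv`).

The `H`-action on `ς⁻¹({x})` is free when `φ` is faithful. Hence, after a choice of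
representatives `(a, u)` of the set `O` of orbits, `^*φ(W)(x)` is the direct sum and `φ^*(W)(x)`
the direct product of the spaces `W(u)`, and the embedding of the sum into the product does not
depend on the choice. It is the natural transformation `comparisonNatTrans`, which sends the class
of `w ∈ W(u)` at `(a, u)` to the transformation `q ↦ W(h)(w)`, for the unique `h` with
`φ(h) = q a`, and `q ↦ 0` if there is no such `h`. When `O` is finite the sum equals the product:
the inverse is `α ↦ ∑ ι_(a, u)(α(a⁻¹))`, a sum over the orbits (`comparisonInv`). Thus `φ` is
Frobenius as soon as all these orbit sets are finite.

Conversely, an abstract natural isomorphism between the two functors, not necessarily the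
canonical one, already forces `O` to be finite (`IsFrobenius.finite_sigma_orbits`). Let `W` be the
constant representation on the free vector space on `O`. An element of `^*φ(W)(x)` is a finite sum
of vectors with finite support, so almost all coordinate projections `W → k` kill it. Naturality
transports this property to `φ^*(W)(x)`, where the transformation sending `q` to the basis vector
of the orbit of `q⁻¹` is killed by no coordinate projection.

For finite groupoids, every orbit of `ς⁻¹({x})` has a representative `(a, u)` with `u` in a finite
set, and each `G(φ(u), x)` is finite (`finite_sigma_orbits`).
-/

namespace GroupoidFrobenius

/-! ### Orbits of the fibres of the pull-back bisets -/

section Fibres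

variable {H G : Type u} [Groupoid.{u} H] [Groupoid.{u} G] {φ : H ⥤ G} {x : G}

/-- The object `u` of the element `(a, u)` of `ς⁻¹({x})`. -/
abbrev sigmaObj (p : RightTranslation (sigmaFibre φ x)) : H :=
  (sigmaFibre φ x).st p.pt

/-- The arrow `a` of the element `(a, u)` of `ς⁻¹({x})`, with its target transported to `x`. -/
def sigmaArr (p : RightTranslation (sigmaFibre φ x)) : φ.obj (sigmaObj p) ⟶ x :=
  p.pt.1.arr ≫ eqToHom p.pt.2

/-- The element `(a, u)` of `ς⁻¹({x})`. -/
def sigmaPt (u : H) (a : φ.obj u ⟶ x) : RightTranslation (sigmaFibre φ x) :=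
  ⟨⟨⟨u, x, a⟩, rfl⟩⟩

@[simp]
theorem sigmaArr_sigmaPt (u : H) (a : φ.obj u ⟶ x) : sigmaArr (sigmaPt u a) = a :=
  Category.comp_id a

theorem sigmaArr_translate {y : G} (g : x ⟶ y) (p : RightTranslation (sigmaFibre φ x)) :
    sigmaArr ((sigmaTranslate φ g).obj p) = sigmaArr p ≫ g := by
  obtain ⟨⟨⟨u, z, a⟩, hp⟩⟩ := p
  change z = x at hp
  subst hp
  change (a ≫ 𝟙 _ ≫ g) ≫ 𝟙 _ = (a ≫ 𝟙 _) ≫ g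
  simp

/-- The condition `q h = p` on an arrow `h` of `H`, expressed by arrows of `G`. -/
theorem sigma_hom_property (p q : RightTranslation (sigmaFibre φ x))
    (h : sigmaObj p ⟶ sigmaObj q) :
    (sigmaFibre φ x).act q.pt h rfl = p.pt ↔ φ.map h ≫ sigmaArr q = sigmaArr p := by
  obtain ⟨⟨⟨u, y, a⟩, hp⟩⟩ := p
  obtain ⟨⟨⟨v, z, b⟩, hq⟩⟩ := q
  change y = x at hp
  change z = x at hq
  subst hp hq
  change u ⟶ v at h
  change _ ↔ φ.map h ≫ b ≫ 𝟙 _ = a ≫ 𝟙 _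
  refine Subtype.ext_iff.trans ?_
  change RightPullback.mk u z (φ.map (h ≫ 𝟙 _) ≫ b) = RightPullback.mk u z a ↔ _
  simp

theorem map_comp_sigmaArr {p q : RightTranslation (sigmaFibre φ x)} (h : p ⟶ q) :
    φ.map h.1 ≫ sigmaArr q = sigmaArr p :=
  (sigma_hom_property p q h.1).1 h.2

/-- The orbit of an element of `ς⁻¹({x})`. -/
def sigmaOrbit (p : RightTranslation (sigmaFibre φ x)) : (sigmaFibre φ x).Orbits :=
  Quotient.mk (connectedSetoid _) p

/-- A representative of an orbit of `ς⁻¹({x})`. -/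
noncomputable def sigmaOut (o : (sigmaFibre φ x).Orbits) : RightTranslation (sigmaFibre φ x) :=
  Quotient.out (s := connectedSetoid _) o

@[simp]
theorem sigmaOrbit_sigmaOut (o : (sigmaFibre φ x).Orbits) : sigmaOrbit (sigmaOut o) = o :=
  Quotient.out_eq (s := connectedSetoid _) o

theorem sigmaOrbit_eq_iff {p q : RightTranslation (sigmaFibre φ x)} :
    sigmaOrbit p = sigmaOrbit q ↔
      ∃ h : sigmaObj p ⟶ sigmaObj q, φ.map h ≫ sigmaArr q = sigmaArr p := by
  refine (Quotient.eq (r := connectedSetoid _)).trans ⟨?_, ?_⟩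
  · rintro ⟨h⟩
    exact ⟨h.1, map_comp_sigmaArr h⟩
  · rintro ⟨h, e⟩
    exact ⟨⟨h, (sigma_hom_property p q h).2 e⟩⟩

theorem sigmaOrbit_sigmaPt_eq_iff {u v : H} {a : φ.obj u ⟶ x} {b : φ.obj v ⟶ x} :
    sigmaOrbit (sigmaPt u a) = sigmaOrbit (sigmaPt v b) ↔ ∃ h : u ⟶ v, φ.map h ≫ b = a := by
  refine sigmaOrbit_eq_iff.trans ?_
  rw [sigmaArr_sigmaPt, sigmaArr_sigmaPt]
  rfl

theorem sigmaOrbit_sigmaPt_eq_iff_out {u : H} {a : φ.obj u ⟶ x}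
    {o : (sigmaFibre φ x).Orbits} :
    sigmaOrbit (sigmaPt u a) = o ↔
      ∃ h : u ⟶ sigmaObj (sigmaOut o), φ.map h ≫ sigmaArr (sigmaOut o) = a := by
  rw [← sigmaOrbit_sigmaOut o, sigmaOrbit_eq_iff, sigmaArr_sigmaPt, sigmaOrbit_sigmaOut]
  rfl

theorem theta_hom_property {u v : H} (a : x ⟶ φ.obj u) (b : x ⟶ φ.obj v) (h : u ⟶ v) :
    (thetaFibre φ x).act h ⟨⟨u, x, a⟩, rfl⟩ rfl = ⟨⟨v, x, b⟩, rfl⟩ ↔ a ≫ φ.map h = b := by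
  refine Subtype.ext_iff.trans ?_
  change LeftPullback.mk v x (a ≫ φ.map (𝟙 _ ≫ h)) = LeftPullback.mk v x b ↔ _
  simp

variable (φ x) in
/-- Inversion of arrows, `(u, a) ↦ (a⁻¹, u)`, as a bijection `ϑ⁻¹({x}) ≃ ς⁻¹({x})`. -/
def thetaEquivSigma :
    LeftTranslation (thetaFibre φ x) ≃ RightTranslation (sigmaFibre φ x) where
  toFun p := sigmaPt p.pt.1.obj (Groupoid.inv (eqToHom p.pt.2.symm ≫ p.pt.1.arr))
  invFun p := ⟨⟨⟨sigmaObj p, x, Groupoid.inv (sigmaArr p)⟩, rfl⟩⟩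
  left_inv p := by
    obtain ⟨⟨⟨u, y, a⟩, hp⟩⟩ := p
    change y = x at hp
    subst hp
    refine LeftTranslation.ext (Subtype.ext ?_)
    change LeftPullback.mk u y (Groupoid.inv (Groupoid.inv (𝟙 _ ≫ a) ≫ 𝟙 _)) = ⟨u, y, a⟩
    simp
  right_inv p := by
    obtain ⟨⟨⟨u, y, a⟩, hp⟩⟩ := p
    change y = x at hp
    subst hp
    refine RightTranslation.ext (Subtype.ext ?_)
    change RightPullback.mk u y (Groupoid.inv (𝟙 _ ≫ Groupoid.inv (a ≫ 𝟙 _))) = ⟨u, y, a⟩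
    simp

variable (φ x) in
/-- The `H`-sets `ϑ⁻¹({x})` and `ς⁻¹({x})` have the same orbits. -/
def thetaOrbitsEquiv : (thetaFibre φ x).Orbits ≃ (sigmaFibre φ x).Orbits :=
  Quotient.congr (ra := connectedSetoid _) (rb := connectedSetoid _) (thetaEquivSigma φ x) <| by
    rintro ⟨⟨⟨u, y, a⟩, hp⟩⟩ ⟨⟨⟨v, z, b⟩, hq⟩⟩
    change y = x at hp
    change z = x at hq
    subst hp hq
    refine Iff.trans ?_ (Quotient.eq (r := connectedSetoid _))
    refine Iff.trans ?_ sigmaOrbit_eq_iff.symm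
    change Nonempty _ ↔ ∃ h : u ⟶ v, φ.map h ≫ Groupoid.inv (𝟙 _ ≫ b) ≫ 𝟙 _
      = Groupoid.inv (𝟙 _ ≫ a) ≫ 𝟙 _
    simp only [Category.id_comp, Category.comp_id, Groupoid.inv_eq_inv, IsIso.comp_inv_eq,
      IsIso.eq_inv_comp]
    constructor
    · rintro ⟨h⟩
      exact ⟨h.1, (theta_hom_property a b h.1).1 h.2⟩
    · rintro ⟨h, e⟩
      exact ⟨⟨h, (theta_hom_property a b h).2 e⟩⟩

/-- Every orbit of `ς⁻¹({x})` contains some `(a, u)` with `u` in a fixed set of representatives of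
the components of `H`, and `G(φ(u), x)` is empty or in bijection with the isotropy group at
`x`. -/
theorem finite_sigma_orbits (hH : Finite (Pi0 H)) (hG : ∀ y : G, Finite (y ⟶ y)) (x : G) :
    Finite (sigmaFibre φ x).Orbits := by
  let r (c : Pi0 H) : H := Quotient.out (s := connectedSetoid H) c
  have hfin (c : Pi0 H) : Finite (φ.obj (r c) ⟶ x) := by
    rcases isEmpty_or_nonempty (φ.obj (r c) ⟶ x) with _ | ⟨⟨b⟩⟩
    · infer_instance
    · exact Finite.of_injective (fun a => Groupoid.inv b ≫ a) fun a a' e => by simpa using e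
  let F (s : Σ c : Pi0 H, φ.obj (r c) ⟶ x) : (sigmaFibre φ x).Orbits :=
    sigmaOrbit (sigmaPt (r s.1) s.2)
  refine Finite.of_surjective F fun o => ?_
  obtain ⟨h⟩ : Nonempty (r (Quotient.mk _ (sigmaObj (sigmaOut o))) ⟶ sigmaObj (sigmaOut o)) :=
    Quotient.exact (s := connectedSetoid H) (Quotient.out_eq _)
  refine ⟨⟨_, φ.map h ≫ sigmaArr (sigmaOut o)⟩, ?_⟩
  exact sigmaOrbit_sigmaPt_eq_iff_out.2 ⟨h, rfl⟩

end Fibres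

/-! ### Finite support in co-induced representations -/

section Coinduction

variable {k : Type u} [Field k] {H G : Type u} [Groupoid.{u} H] [Groupoid.{u} G] {φ : H ⥤ G}

/-- In `^*φ(W)(x)`, a vector `w` at `(a φ(h), s(h))` is identified with `W(h)(w)` at
`(a, t(h))`. -/
theorem coindι_w (W : GRep k H) (x : G) {p q : RightTranslation (sigmaFibre φ x)}
    (h : sigmaObj p ⟶ sigmaObj q) (e : φ.map h ≫ sigmaArr q = sigmaArr p)
    (w : W.obj (sigmaObj p)) :
    (coindι φ W x q).hom ((W.map h).hom w) = (coindι φ W x p).hom w :=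
  congrArg (fun f => f.hom w) (colimit.w (fibreDiagram φ W x)
    (⟨h, (sigma_hom_property p q h).2 e⟩ : p ⟶ q))

/-- The vector space `^*φ(W)(x)` is spanned by the images of the structural maps. -/
theorem coind_induction (W : GRep k H) (x : G) {P : coindSpace φ W x → Prop}
    (h0 : P 0) (hadd : ∀ a b, P a → P b → P (a + b)) (hsmul : ∀ (c : k) (a), P a → P (c • a))
    (hι : ∀ p w, P ((coindι φ W x p).hom w)) (a : coindSpace φ W x) : P a := by
  let S : Submodule k (coindSpace φ W x) :=
    Submodule.span k {b | ∃ p w, b = (coindι φ W x p).hom w}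
  have hmkQ : ModuleCat.ofHom S.mkQ = 0 := by
    refine coind_hom_ext φ W x fun p => ?_
    ext w
    exact (Submodule.Quotient.mk_eq_zero S).2 (Submodule.subset_span ⟨p, w, rfl⟩)
  have ha : a ∈ S :=
    (Submodule.Quotient.mk_eq_zero S).1 (congrArg (fun f => f.hom a) hmkQ)
  induction ha using Submodule.span_induction with
  | mem b hb => obtain ⟨p, w, rfl⟩ := hb; exact hι p w
  | zero => exact h0
  | add b c _ _ hb hc => exact hadd b c hb hc
  | smul c b _ hb => exact hsmul c b hb

/-- An element of `^*φ(W)(x)` is a finite sum of images of vectors under the structural maps. If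
`W` is constant and each vector is killed by almost all members of a family of linear maps, then so
is each element of `^*φ(W)(x)`. -/
theorem finite_setOf_coindPost_ne_zero {x : G} {J : Type u} {V : ModuleCat.{u} k}
    (b : coindSpace φ ((Functor.const H).obj (ModuleCat.of k (J →₀ k))) x)
    (π : J → (ModuleCat.of k (J →₀ k) ⟶ V))
    (hπ : ∀ w : J →₀ k, {j | (π j).hom w ≠ 0}.Finite) :
    {j | (coindPost φ ((Functor.const H).map (π j)) x).hom b ≠ 0}.Finite := by
  induction b using coind_induction with
  | h0 => simp
  | hadd a b ha hb =>
    refine (ha.union hb).subset fun j hj => ?_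
    by_contra hn
    simp only [Set.mem_union, Set.mem_ofPred_eq, not_or, not_not] at hn
    exact hj (by rw [map_add, hn.1, hn.2, add_zero])
  | hsmul c a ha =>
    refine ha.subset fun j hj h => hj ?_
    rw [map_smul, h, smul_zero]
  | hι p w =>
    refine (hπ w).subset fun j hj h => hj ?_
    refine (congrArg (fun f => f.hom w)
      (coindι_post φ ((Functor.const H).map (π j)) x p)).trans ?_
    exact (congrArg (coindι φ ((Functor.const H).obj V) x p).hom h).trans (map_zero _)

/-- A Frobenius morphism has finite orbit sets. With `O` the orbit set of `ς⁻¹({x})`, the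
natural transformation `a⁻¹ ↦ e_{[a]}` into the constant representation on the free vector space
on `O` has all coordinates nonzero, whereas an element of the co-induced space has only finitely
many nonzero coordinates. -/
theorem IsFrobenius.finite_sigma_orbits (hφ : IsFrobenius k φ) (x : G) :
    Finite (sigmaFibre φ x).Orbits := by
  obtain ⟨η⟩ := hφ
  let O := (sigmaFibre φ x).Orbits
  let W : GRep k H := (Functor.const H).obj (ModuleCat.of k (O →₀ k))
  let π (o : O) : ModuleCat.of k (O →₀ k) ⟶ ModuleCat.of k k :=
    ModuleCat.ofHom (Finsupp.lapply o)
  let orb (u : H) (q : x ⟶ φ.obj u) : O := sigmaOrbit (sigmaPt u (Groupoid.inv q))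
  let α : natSpace φ W x := ⟨fun u q => Finsupp.single (orb u q) 1, fun u v h q => by
    have : orb v (q ≫ φ.map h) = orb u q :=
      Eq.symm <| sigmaOrbit_sigmaPt_eq_iff.2 ⟨h, by simp⟩
    exact congrArg (fun o => Finsupp.single o (1 : k)) this⟩
  let b : coindSpace φ W x := ((η.hom.app W).app x).hom α
  have hfin := finite_setOf_coindPost_ne_zero b π fun w =>
    (w.support.finite_toSet).subset fun o ho => Finsupp.mem_support_iff.2 ho
  refine Set.finite_univ_iff.1 (hfin.subset fun o _ h0 => ?_)
  have hnat := congrArg (fun f => (f.app x).hom α) (η.hom.naturality ((Functor.const H).map (π o)))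
  have hzero : ((η.hom.app _).app x).hom (natPost φ ((Functor.const H).map (π o)) x α) = 0 :=
    hnat.trans h0
  have hinv := congrArg (fun f => (f.app x).hom (natPost φ ((Functor.const H).map (π o)) x α))
    (η.hom_inv_id_app ((Functor.const H).obj (ModuleCat.of k k)))
  -- injectivity of `η` at `x`
  have hα : natPost φ ((Functor.const H).map (π o)) x α = 0 := by
    refine hinv.symm.trans ?_
    change ((η.inv.app _).app x).hom (((η.hom.app _).app x).hom _) = 0
    rw [hzero, map_zero]
  have h1 := congrFun (congrFun (congrArg Subtype.val hα) (sigmaObj (sigmaOut o)))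
    (Groupoid.inv (sigmaArr (sigmaOut o)))
  change Finsupp.single (orb _ _) (1 : k) o = 0 at h1
  have ho : orb (sigmaObj (sigmaOut o)) (Groupoid.inv (sigmaArr (sigmaOut o))) = o :=
    sigmaOrbit_sigmaPt_eq_iff_out.2 ⟨𝟙 _, by simp⟩
  rw [ho, Finsupp.single_eq_same] at h1
  exact one_ne_zero h1

end Coinduction

/-! ### The comparison of co-induction with induction -/

section Comparison

variable {k : Type u} [Field k] {H G : Type u} [Groupoid.{u} H] [Groupoid.{u} G] {φ : H ⥤ G}

open Classical in
/-- The extension of `W` by zero to the arrows `φ(u) ⟶ φ(v)` of `G`: the linear map `W(h)` on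
`φ(h)`, and zero on arrows that are not of the form `φ(h)` with `h : u ⟶ v`. The choice of `h` is
immaterial when `φ` is faithful. -/
noncomputable def extendByZero (W : GRep k H) {u v : H} (r : φ.obj u ⟶ φ.obj v) :
    W.obj u →ₗ[k] W.obj v :=
  if h : ∃ h : u ⟶ v, φ.map h = r then (W.map h.choose).hom else 0

theorem extendByZero_of_not (W : GRep k H) {u v : H} {r : φ.obj u ⟶ φ.obj v}
    (hr : ¬ ∃ h : u ⟶ v, φ.map h = r) : extendByZero W r = 0 :=
  dif_neg hr

variable [φ.Faithful]

theorem extendByZero_of_eq (W : GRep k H) {u v : H} {r : φ.obj u ⟶ φ.obj v} (h : u ⟶ v)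
    (hr : φ.map h = r) : extendByZero W r = (W.map h).hom := by
  have hex : ∃ h : u ⟶ v, φ.map h = r := ⟨h, hr⟩
  rw [extendByZero, dif_pos hex, φ.map_injective (hex.choose_spec.trans hr.symm)]

theorem extendByZero_comp_map (W : GRep k H) {u v v' : H} (r : φ.obj u ⟶ φ.obj v) (l : v ⟶ v')
    (w : W.obj u) : extendByZero W (r ≫ φ.map l) w = (W.map l).hom (extendByZero W r w) := by
  by_cases hr : ∃ h : u ⟶ v, φ.map h = r
  · obtain ⟨h, hr⟩ := hr
    rw [extendByZero_of_eq W h hr, extendByZero_of_eq W (h ≫ l) (by simp [hr])]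
    simp
  · rw [extendByZero_of_not W hr, extendByZero_of_not W]
    · simp
    · rintro ⟨h, e⟩
      exact hr ⟨h ≫ Groupoid.inv l, by simp [e]⟩

theorem extendByZero_map_comp (W : GRep k H) {u u' v : H} (l : u ⟶ u') (r : φ.obj u' ⟶ φ.obj v)
    (w : W.obj u) : extendByZero W (φ.map l ≫ r) w = extendByZero W r ((W.map l).hom w) := by
  by_cases hr : ∃ h : u' ⟶ v, φ.map h = r
  · obtain ⟨h, hr⟩ := hr
    rw [extendByZero_of_eq W h hr, extendByZero_of_eq W (l ≫ h) (by simp [hr])]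
    simp
  · rw [extendByZero_of_not W hr, extendByZero_of_not W]
    · simp
    · rintro ⟨h, e⟩
      exact hr ⟨Groupoid.inv l ≫ h, by simp [e]⟩

theorem extendByZero_naturality {W W' : GRep k H} (f : W ⟶ W') {u v : H}
    (r : φ.obj u ⟶ φ.obj v) (w : W.obj u) :
    extendByZero W' r ((f.app u).hom w) = (f.app v).hom (extendByZero W r w) := by
  by_cases hr : ∃ h : u ⟶ v, φ.map h = r
  · obtain ⟨h, hr⟩ := hr
    rw [extendByZero_of_eq W h hr, extendByZero_of_eq W' h hr,
      ← ModuleCat.comp_apply, ← ModuleCat.comp_apply, f.naturality]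
  · rw [extendByZero_of_not W hr, extendByZero_of_not W' hr]
    simp

/-- The component `W(u) → φ^*(W)(x)` at `(a, u)` of the comparison map from co-induction to
induction: it sends `w` to the transformation whose value at `q : x ⟶ φ(v)` is `W(h)(w)` if the
product `q a` is `φ(h)`, and zero if it is not in the image of `φ`. -/
noncomputable def comparisonι (W : GRep k H) {x : G} (p : RightTranslation (sigmaFibre φ x)) :
    W.obj (sigmaObj p) →ₗ[k] natSpace φ W x where
  toFun w := ⟨fun _ q => extendByZero W (sigmaArr p ≫ q) w, fun _ _ l q => by
    refine Eq.trans ?_ (extendByZero_comp_map W (sigmaArr p ≫ q) l w)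
    rw [Category.assoc]⟩
  map_add' w w' := Subtype.ext <| funext fun _ => funext fun _ => map_add _ w w'
  map_smul' c w := Subtype.ext <| funext fun _ => funext fun _ => map_smul _ c w

theorem comparisonι_apply (W : GRep k H) {x : G} (p : RightTranslation (sigmaFibre φ x))
    (w : W.obj (sigmaObj p)) {v : H} (q : x ⟶ φ.obj v) :
    (comparisonι W p w).1 v q = extendByZero W (sigmaArr p ≫ q) w :=
  rfl

/-- The canonical map `^*φ(W)(x) → φ^*(W)(x)`, the analogue of the embedding of a direct sum into
the corresponding product. -/
noncomputable def comparison (W : GRep k H) (x : G) :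
    coindSpace φ W x ⟶ ModuleCat.of k (natSpace φ W x) :=
  colimit.desc (fibreDiagram φ W x)
    { pt := ModuleCat.of k (natSpace φ W x)
      ι :=
        { app := fun p => ModuleCat.ofHom (comparisonι W p)
          naturality := fun p p' l => by
            ext w
            refine Subtype.ext <| funext fun v => funext fun q => ?_
            refine (extendByZero_map_comp W l.1 (sigmaArr p' ≫ q) w).symm.trans ?_
            refine congrArg (fun r : φ.obj (sigmaObj p) ⟶ φ.obj v => extendByZero W r w) ?_
            rw [← Category.assoc, map_comp_sigmaArr] } }

theorem comparison_coindι (W : GRep k H) (x : G) (p : RightTranslation (sigmaFibre φ x))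
    (w : W.obj (sigmaObj p)) :
    (comparison W x).hom ((coindι φ W x p).hom w) = comparisonι W p w := by
  have h : coindι φ W x p ≫ comparison W x = ModuleCat.ofHom (comparisonι W p) :=
    colimit.ι_desc _ _
  exact congrArg (fun f => f.hom w) h

variable (k φ) in
/-- The canonical natural transformation from co-induction to induction. -/
noncomputable def comparisonNatTrans : coinduction k φ ⟶ induction k φ where
  app W :=
    { app := fun x => comparison W x
      naturality := fun x y g => coind_hom_ext φ W x fun p => by
        ext w
        refine (congrArg (comparison W y).hom
          (congrArg (fun f => f.hom w) (coindι_map φ W g p))).trans ?_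
        refine (comparison_coindι W y ((sigmaTranslate φ g).obj p) w).trans ?_
        refine Eq.trans ?_ (congrArg (natMap φ W g) (comparison_coindι W x p w)).symm
        refine Subtype.ext <| funext fun v => funext fun q => ?_
        refine congrArg (fun r : φ.obj (sigmaObj p) ⟶ φ.obj v => extendByZero W r w) ?_
        exact (congrArg (· ≫ q) (sigmaArr_translate g p)).trans (Category.assoc _ _ _) }
  naturality W W' f := by
    ext1
    funext x
    refine coind_hom_ext φ W x fun p => ?_
    ext w
    refine (congrArg (comparison W' x).hom
      (congrArg (fun f => f.hom w) (coindι_post φ f x p))).trans ?_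
    refine (comparison_coindι W' x p ((f.app _).hom w)).trans ?_
    refine Eq.trans ?_ (congrArg (natPost φ f x) (comparison_coindι W x p w)).symm
    exact Subtype.ext <| funext fun _ => funext fun _ => extendByZero_naturality f _ w

/-- For finitely many orbits, the map `α ↦ ∑ ι_(a, u)(α(a⁻¹))`, where `(a, u)` runs through
representatives of the orbits. -/
noncomputable def comparisonInv (W : GRep k H) (x : G) [Fintype (sigmaFibre φ x).Orbits] :
    natSpace φ W x →ₗ[k] coindSpace φ W x where
  toFun α := ∑ o : (sigmaFibre φ x).Orbits, (coindι φ W x (sigmaOut o)).hom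
    (α.1 _ (Groupoid.inv (sigmaArr (sigmaOut o))))
  map_add' α β := by
    rw [← Finset.sum_add_distrib]
    exact Finset.sum_congr rfl fun o _ => map_add (coindι φ W x (sigmaOut o)).hom _ _
  map_smul' c α := by
    rw [RingHom.id_apply, Finset.smul_sum]
    exact Finset.sum_congr rfl fun o _ => map_smul (coindι φ W x (sigmaOut o)).hom _ _

theorem comparisonInv_comparison (W : GRep k H) (x : G) [Fintype (sigmaFibre φ x).Orbits]
    (b : coindSpace φ W x) : comparisonInv W x ((comparison W x).hom b) = b := by
  induction b using coind_induction with
  | h0 => rw [map_zero, map_zero]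
  | hadd a b ha hb => rw [map_add, map_add, ha, hb]
  | hsmul c a ha => rw [map_smul, map_smul, ha]
  | hι p w =>
    rw [comparison_coindι]
    refine (Finset.sum_eq_single (sigmaOrbit p) (fun o _ ho => ?_)
      (fun h => (h (Finset.mem_univ _)).elim)).trans ?_
    · rw [comparisonι_apply, extendByZero_of_not W, LinearMap.zero_apply, map_zero]
      rintro ⟨h, e⟩
      refine ho ((sigmaOrbit_sigmaOut o).symm.trans (sigmaOrbit_eq_iff.2 ⟨h, ?_⟩).symm)
      simp [e]
    · obtain ⟨h, e⟩ := sigmaOrbit_eq_iff.1 (sigmaOrbit_sigmaOut (sigmaOrbit p)).symm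
      rw [comparisonι_apply, extendByZero_of_eq W h (by simp [← e])]
      exact coindι_w W x h e w

theorem comparison_comparisonInv (W : GRep k H) (x : G) [Fintype (sigmaFibre φ x).Orbits]
    (α : natSpace φ W x) : (comparison W x).hom (comparisonInv W x α) = α := by
  refine Subtype.ext <| funext fun v => funext fun q => ?_
  let ev : natSpace φ W x →ₗ[k] W.obj v :=
    (LinearMap.proj q ∘ₗ LinearMap.proj v) ∘ₗ (natSpace φ W x).subtype
  change ev ((comparison W x).hom (∑ o : (sigmaFibre φ x).Orbits, _)) = α.1 v q
  rw [map_sum, map_sum]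
  -- only the orbit of `(q⁻¹, v)` contributes to the value at `q`
  refine (Finset.sum_eq_single (sigmaOrbit (sigmaPt v (Groupoid.inv q))) (fun o _ ho => ?_)
    (fun h => (h (Finset.mem_univ _)).elim)).trans ?_
  · rw [comparison_coindι]
    change extendByZero W (sigmaArr (sigmaOut o) ≫ q) _ = 0
    rw [extendByZero_of_not W, LinearMap.zero_apply]
    rintro ⟨h, e⟩
    exact ho (sigmaOrbit_sigmaPt_eq_iff_out.2 ⟨Groupoid.inv h, by
      simp [e]⟩).symm
  · rw [comparison_coindι]
    obtain ⟨h, e⟩ := sigmaOrbit_sigmaPt_eq_iff_out.1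
      (rfl : sigmaOrbit (sigmaPt v (Groupoid.inv q)) = _)
    generalize sigmaOut (sigmaOrbit (sigmaPt v (Groupoid.inv q))) = p at h e
    change extendByZero W (sigmaArr p ≫ q) _ = α.1 v q
    have e' : φ.map (Groupoid.inv h) = sigmaArr p ≫ q := by
      rw [Groupoid.inv_eq_inv, Functor.map_inv, IsIso.inv_eq_of_hom_inv_id]
      rw [← Category.assoc, e, Groupoid.inv_comp]
    rw [extendByZero_of_eq W _ e', ← α.2, e']
    simp

theorem isFrobenius_of_finite_sigma_orbits (hfin : ∀ x : G, Finite (sigmaFibre φ x).Orbits) :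
    IsFrobenius k φ := by
  have hiso (W : GRep k H) (x : G) : IsIso (comparison (φ := φ) W x) := by
    have := Fintype.ofFinite (sigmaFibre φ x).Orbits
    refine ⟨ModuleCat.ofHom (comparisonInv W x), ?_, ?_⟩
    · ext b
      exact comparisonInv_comparison W x b
    · ext α : 2
      exact comparison_comparisonInv W x α
  have (W : GRep k H) : IsIso ((comparisonNatTrans k φ).app W) := by
    have (x : G) : IsIso (((comparisonNatTrans k φ).app W).app x) := hiso W x
    exact NatIso.isIso_of_isIso_app _
  have : IsIso (comparisonNatTrans k φ) := NatIso.isIso_of_isIso_app _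
  exact ⟨(asIso (comparisonNatTrans k φ)).symm⟩

end Comparison

end GroupoidFrobenius

theorem mainTheorem2 (k : Type u) [Field k] {H G : Type u} [Groupoid.{u} H] [Groupoid.{u} G]
    (φ : H ⥤ G) (hfaithful : φ.Faithful) (hinj : Function.Injective φ.obj) :
    List.TFAE
      [GroupoidFrobenius.IsFrobenius k φ,
        ∀ x : G, Finite (GroupoidFrobenius.thetaFibre φ x).Orbits,
        ∀ x : G, Finite (GroupoidFrobenius.sigmaFibre φ x).Orbits] ∧
    (GroupoidFrobenius.IsFiniteGroupoid H → GroupoidFrobenius.IsFiniteGroupoid G →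
      GroupoidFrobenius.IsFrobenius k φ) := by
  have hca (h : ∀ x : G, Finite (GroupoidFrobenius.sigmaFibre φ x).Orbits) :
      GroupoidFrobenius.IsFrobenius k φ :=
    GroupoidFrobenius.isFrobenius_of_finite_sigma_orbits h
  refine ⟨?_, fun hH hG => hca fun x => GroupoidFrobenius.finite_sigma_orbits hH.1 hG.2 x⟩
  tfae_have 1 → 3 := fun h x => h.finite_sigma_orbits x
  tfae_have 3 → 1 := hca
  tfae_have 2 ↔ 3 := forall_congr' fun x => (GroupoidFrobenius.thetaOrbitsEquiv φ x).finite_iff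
  tfae_finish
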